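/- For a permutation $\pi$ of $\{1,\dots,n\}$ (where $n\ge 0$), write $|\pi|=n$ and let $\mathrm{fp}(\pi)=\#\{i:\pi(i)=i\}$ be its number of fixed points, $\mathrm{exc}(\pi)=\#\{i: i<\pi(i)\}$ its number of excedances, $\mathrm{dexc}(\pi)=\#\{i: i<\pi(i)<\pi(\pi(i))\}$ its number of double excedances, $\mathrm{cyc}(\pi)$ its number of cycles (fixed points counted as cycles), and $\mathrm{inv}(\pi)=\#\{(i,j): i<j,\ \pi(i)>\pi(j)\}$ its number of inversions. An involution is a permutation equal to its inverse. A permutation $\pi$ is $321$-avoiding if there are no $i<j<k$ with $\pi(i)>\pi(j)>\pi(k)$. Write $[h]_{p}=1+p+\dots+p^{h-1}$. For sequences $\mathbf d=(d_1,d_2,\dots)$ and $\boldsymbol\ell=(\ell_0,\ell_1,\dots)$ in a commutative ring $R$, let $$J_{\mathbf d,\boldsymbol\ell}(z)=\cfrac{1}{1-\ell_0z-\cfrac{d_1z^2}{1-\ell_1z-\cfrac{d_2z^2}{1-\ell_2z-\cdots}}}\in R[[z]],$$ the coefficientwise limit of the finite truncations of the continued fraction. Let $x,v,t,q$ be elements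 of a commutative ring $R$ (for instance independent variables). Involutions have no double excedances, that is, $\mathrm{dexc}(\pi)=0$ for every involution $\pi$. Moreover, as formal power series in $z$: (1) $\displaystyle\sum_{\pi\ \text{involution}} x^{\mathrm{fp}(\pi)}v^{\mathrm{exc}(\pi)}t^{\mathrm{cyc}(\pi)}q^{\mathrm{inv}(\pi)}z^{|\pi|}=J_{\mathbf d,\boldsymbol\ell}(z)$ with $d_h=vtq^{2h-1}[h]_{q^2}$ for $h\ge1$ and $\ell_h=xtq^{2h}$ for $h\ge0$; (2) $\displaystyle\sum_{\pi\ 321\text{-avoiding involution}} x^{\mathrm{fp}(\pi)}v^{\mathrm{exc}(\pi)}t^{\mathrm{cyc}(\pi)}q^{\mathrm{inv}(\pi)}z^{|\pi|}=J_{\mathbf d,\boldsymbol\ell}(z)$ with $d_h=vtq^{2h-1}$ for $h\ge1$, $\ell_0=xt$, and $\ell_h=0$ for $h\ge1$. Both sums run over all such permutations of all lengths $n\ge0$. -/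

import Mathlib

/-!
Both expansions specialize a single one that also records, by a variable `p`, the nestings of an
involution, i.e. the pairs `i < k ≤ π k < π i`: the coefficients are
`d_h = v t q ^ (2 h - 1) [h]_{q² p}` and `l_h = x t (q² p) ^ h`. At `p = 1` this is the expansion
for all involutions. At `p = 0` only the involutions without nestings survive, and these are the
`321`-avoiding ones.

To prove it, read an involution from left to right and keep track of the set `L` of positions whose
arc is still open. A position may open an arc, be a fixed point, or close the arc opened at one of
the `j ∈ L`. Every open arc passes over a fixed point, which costs two inversions and one nesting
per open arc. Closing the arc from `j` costs one inversion for the arc itself and two for each other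
open arc. The arcs opened after `j` only cross it, but those opened before `j` pass over it and cost
a further two inversions and one nesting each; summing over `j` yields `[h]_{q² p}` with `h = |L|`.
Hence the generating polynomials satisfy the recursion of weighted Motzkin paths at height `|L|`,
and these paths are counted by the J-fraction.
-/

open PowerSeries

namespace PermJFraction

section Statistics

variable {n : ℕ}

/-- The number of fixed points of `π`. -/
def fp (π : Equiv.Perm (Fin n)) : ℕ := (Finset.univ.filter fun i => π i = i).card

/-- The number of excedances of `π`, that is, of values `π i` with `i < π i`. -/
def exc (π : Equiv.Perm (Fin n)) : ℕ := (Finset.univ.filter fun i => i < π i).card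

/-- The number of double excedances of `π`, that is, of values `π i` with `i < π i < π (π i)`. -/
def dexc (π : Equiv.Perm (Fin n)) : ℕ :=
  (Finset.univ.filter fun i => i < π i ∧ π i < π (π i)).card

/-- The number of cycles of `π`, fixed points included: the number of parts of the partition
of `n` formed by the lengths of all cycles. -/
def cyc (π : Equiv.Perm (Fin n)) : ℕ := Multiset.card π.partition.parts

/-- The number of inversions of `π`: pairs of positions `i < j` with `π j < π i`. -/
def inv (π : Equiv.Perm (Fin n)) : ℕ :=
  (Finset.univ.filter fun p : Fin n × Fin n => p.1 < p.2 ∧ π p.2 < π p.1).card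

/-- `π` is an involution: it is equal to its inverse (the identity is allowed). -/
def IsInvolution (π : Equiv.Perm (Fin n)) : Prop := π⁻¹ = π

/-- `π` avoids the classical pattern `σ`: no subsequence of `π` is in the same relative order
as `σ`. -/
def Avoids {m : ℕ} (π : Equiv.Perm (Fin n)) (σ : Equiv.Perm (Fin m)) : Prop :=
  ¬ ∃ f : Fin m → Fin n, StrictMono f ∧ ∀ a b, π (f a) < π (f b) ↔ σ a < σ b

end Statistics

/-- The permutation `321`, which reverses the order of three points. -/
def pattern321 : Equiv.Perm (Fin 3) := Fin.revPerm

section Series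

variable {R : Type*} [CommRing R]

open Classical in
/-- `∑ x ^ fp π * v ^ exc π * t ^ cyc π * q ^ inv π * z ^ n`, summed over all `n ≥ 0` and all
permutations `π` of `n` points that satisfy `P`, as a formal power series in `z`. -/
noncomputable def genFun (P : ∀ n : ℕ, Equiv.Perm (Fin n) → Prop) (x v t q : R) : PowerSeries R :=
  PowerSeries.mk fun n =>
    ∑ π ∈ (Finset.univ : Finset (Equiv.Perm (Fin n))).filter (fun π => P n π),
      x ^ fp π * v ^ exc π * t ^ cyc π * q ^ inv π

/-- The `q`-integer `[h]_q = 1 + q + ⋯ + q ^ (h - 1)`. -/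
def qInt (h : ℕ) (q : R) : R := ∑ i ∈ Finset.range h, q ^ i

/-- The finite J-fraction
`1 / (1 - l_h z - d_{h+1} z² / (1 - l_{h+1} z - ⋯ - d_{h+N} z² / (1 - l_{h+N} z)))`.
Each denominator has constant coefficient `1` and `invOfUnit _ 1` is its inverse. -/
noncomputable def jConvergent (d l : ℕ → R) : ℕ → ℕ → PowerSeries R
  | 0, h => invOfUnit (1 - C (l h) * X) 1
  | N + 1, h => invOfUnit (1 - C (l h) * X - C (d (h + 1)) * X ^ 2 * jConvergent d l N (h + 1)) 1

/-- The infinite J-fraction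
`J_{d,l}(z) = 1 / (1 - l_0 z - d_1 z² / (1 - l_1 z - d_2 z² / (1 - l_2 z - ⋯)))`,
the coefficientwise limit of its convergents. The coefficient of `z ^ n` is constant from the
`n`-th convergent on (`coeff_jConvergent`). The value `d 0` is not used. -/
noncomputable def jFraction (d l : ℕ → R) : PowerSeries R :=
  PowerSeries.mk fun n => coeff n (jConvergent d l n 0)

lemma X_pow_dvd_invOfUnit_sub {a b : PowerSeries R} (ha : constantCoeff a = 1)
    (hb : constantCoeff b = 1) {k : ℕ} (h : X ^ k ∣ b - a) :
    X ^ k ∣ invOfUnit a 1 - invOfUnit b 1 := by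
  have h1 : a * invOfUnit a 1 = 1 := mul_invOfUnit a 1 (by simpa using ha)
  have h2 : b * invOfUnit b 1 = 1 := mul_invOfUnit b 1 (by simpa using hb)
  have : invOfUnit a 1 - invOfUnit b 1 = (b - a) * (invOfUnit a 1 * invOfUnit b 1) := by
    linear_combination (invOfUnit b 1) * h1 - (invOfUnit a 1) * h2
  rw [this]
  exact h.mul_right _

lemma X_pow_dvd_jConvergent_sub (d l : ℕ → R) (N M : ℕ) (hNM : N ≤ M) (h : ℕ) :
    X ^ (N + 1) ∣ jConvergent d l N h - jConvergent d l M h := by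
  induction N generalizing M h with
  | zero =>
    rw [X_pow_dvd_iff]
    intro m hm
    obtain rfl : m = 0 := by omega
    cases M <;> simp [jConvergent]
  | succ N ih =>
    obtain ⟨M, rfl⟩ : ∃ M', M = M' + 1 := ⟨M - 1, by omega⟩
    simp only [jConvergent]
    apply X_pow_dvd_invOfUnit_sub (by simp) (by simp)
    obtain ⟨c, hc⟩ := ih M (by omega) (h + 1)
    exact ⟨C (d (h + 1)) * X * c, by linear_combination C (d (h + 1)) * X ^ 2 * hc⟩

/-- The convergents converge coefficientwise to `jFraction d l`. -/
theorem coeff_jConvergent (d l : ℕ → R) {n N : ℕ} (h : n ≤ N) :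
    coeff n (jConvergent d l N 0) = coeff n (jFraction d l) := by
  have := X_pow_dvd_iff.1 (X_pow_dvd_jConvergent_sub d l n N h 0) n (by omega)
  rw [map_sub, sub_eq_zero] at this
  rw [jFraction, coeff_mk, this]

end Series

end PermJFraction

namespace PermJFraction

section MotzkinPaths

variable {R : Type*}

/-- The weighted number of Motzkin paths with `n` steps from height `h` to height `0`. Up steps
have weight `1`, level steps at height `h` weight `l h`, and down steps from height `h` weight
`d h`. -/
def motzkin [Semiring R] (d l : ℕ → R) : ℕ → ℕ → R
  | 0, 0 => 1
  | 0, _ + 1 => 0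
  | n + 1, 0 => motzkin d l n 1 + l 0 * motzkin d l n 0
  | n + 1, h + 1 =>
    motzkin d l n (h + 2) + l (h + 1) * motzkin d l n (h + 1) + d (h + 1) * motzkin d l n h

lemma motzkin_congr [Semiring R] {d d' l : ℕ → R} (hd : ∀ h, d (h + 1) = d' (h + 1)) (n h : ℕ) :
    motzkin d l n h = motzkin d' l n h := by
  induction n generalizing h with
  | zero => cases h <;> rfl
  | succ n ih => cases h <;> simp only [motzkin, ih, hd]

variable [CommRing R]

/-- The tail `1 / (1 - l_h z - d_{h+1} z² / (1 - l_{h+1} z - ⋯))` of the J-fraction, in which the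
sequences `d` and `l` are read from level `h` on. -/
noncomputable def jTail (d l : ℕ → R) (h : ℕ) : PowerSeries R :=
  PowerSeries.mk fun n => coeff n (jConvergent d l n h)

lemma jTail_zero (d l : ℕ → R) : jTail d l 0 = jFraction d l := rfl

lemma X_pow_dvd_jTail_sub_jConvergent (d l : ℕ → R) (N h : ℕ) :
    X ^ (N + 1) ∣ jTail d l h - jConvergent d l N h := by
  rw [X_pow_dvd_iff]
  intro m hm
  have := X_pow_dvd_iff.1 (X_pow_dvd_jConvergent_sub d l m N (by omega) h) m (by omega)
  rwa [map_sub, jTail, coeff_mk, ← map_sub]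

lemma jConvergent_succ_mul (d l : ℕ → R) (N h : ℕ) :
    jConvergent d l (N + 1) h *
      (1 - C (l h) * X - C (d (h + 1)) * X ^ 2 * jConvergent d l N (h + 1)) = 1 := by
  rw [jConvergent, mul_comm]
  exact mul_invOfUnit _ 1 (by simp)

lemma jTail_mul (d l : ℕ → R) (h : ℕ) :
    jTail d l h * (1 - C (l h) * X - C (d (h + 1)) * X ^ 2 * jTail d l (h + 1)) = 1 := by
  suffices hdvd : ∀ N, X ^ (N + 1) ∣
      jTail d l h * (1 - C (l h) * X - C (d (h + 1)) * X ^ 2 * jTail d l (h + 1)) - 1 by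
    ext n
    rw [← sub_eq_zero, ← map_sub]
    exact X_pow_dvd_iff.1 (hdvd n) n (by omega)
  intro N
  have hh : X ^ (N + 1) ∣ jTail d l h - jConvergent d l (N + 1) h :=
    (pow_dvd_pow X (by omega)).trans (X_pow_dvd_jTail_sub_jConvergent d l (N + 1) h)
  obtain ⟨a, ha⟩ := hh
  obtain ⟨b, hb⟩ := X_pow_dvd_jTail_sub_jConvergent d l N (h + 1)
  refine ⟨a * (1 - C (l h) * X - C (d (h + 1)) * X ^ 2 * jTail d l (h + 1))
    - jConvergent d l (N + 1) h * C (d (h + 1)) * X ^ 2 * b, ?_⟩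
  linear_combination jConvergent_succ_mul d l N h
    + (1 - C (l h) * X - C (d (h + 1)) * X ^ 2 * jTail d l (h + 1)) * ha
    - jConvergent d l (N + 1) h * C (d (h + 1)) * X ^ 2 * hb

/-- The generating function of the Motzkin paths from height `h` to height `0`, factored at the
first visits to the heights `h - 1, …, 0`. -/
noncomputable def motzkinSeries (d l : ℕ → R) : ℕ → PowerSeries R
  | 0 => jTail d l 0
  | h + 1 => C (d (h + 1)) * X * jTail d l (h + 1) * motzkinSeries d l h

lemma motzkinSeries_zero_eq (d l : ℕ → R) :
    motzkinSeries d l 0 = 1 + X * (motzkinSeries d l 1 + C (l 0) * motzkinSeries d l 0) := by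
  simp only [motzkinSeries]
  linear_combination jTail_mul d l 0

lemma motzkinSeries_succ_eq (d l : ℕ → R) (h : ℕ) :
    motzkinSeries d l (h + 1) = X * (motzkinSeries d l (h + 2)
      + C (l (h + 1)) * motzkinSeries d l (h + 1) + C (d (h + 1)) * motzkinSeries d l h) := by
  simp only [motzkinSeries]
  linear_combination C (d (h + 1)) * X * motzkinSeries d l h * jTail_mul d l (h + 1)

lemma coeff_motzkinSeries (d l : ℕ → R) (n h : ℕ) :
    coeff n (motzkinSeries d l h) = motzkin d l n h := by
  induction n generalizing h with
  | zero =>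
    cases h with
    | zero => rw [motzkinSeries_zero_eq]; simp [motzkin]
    | succ h => rw [motzkinSeries_succ_eq]; simp [motzkin]
  | succ n ih =>
    cases h with
    | zero =>
      rw [motzkinSeries_zero_eq, map_add, coeff_succ_X_mul]
      simp [motzkin, ih, coeff_one]
    | succ h =>
      rw [motzkinSeries_succ_eq, coeff_succ_X_mul]
      simp [motzkin, ih]

theorem coeff_jFraction (d l : ℕ → R) (n : ℕ) : coeff n (jFraction d l) = motzkin d l n 0 := by
  rw [← jTail_zero]
  exact coeff_motzkinSeries d l n 0

lemma jFraction_congr {d d' l : ℕ → R} (hd : ∀ h, d (h + 1) = d' (h + 1)) :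
    jFraction d l = jFraction d' l := by
  ext n
  rw [coeff_jFraction, coeff_jFraction, motzkin_congr hd]

end MotzkinPaths

section OpenInvolutions

open Finset Function

variable {α : Type*} [DecidableEq α] [Fintype α] {L M : Finset α} {j m : α} {π : Equiv.Perm α}

open Classical in
/-- The involutions that fix every point outside `L ∪ M` and send `L` into `M`. When a permutation
is read from left to right, `L` is the set of positions already read whose arc is still open, and
`M` is the set of positions still to be read. -/
noncomputable def openInvolutions (L M : Finset α) : Finset (Equiv.Perm α) :=
  {π | Involutive π ∧ (∀ i ∉ L ∪ M, π i = i) ∧ ∀ i ∈ L, π i ∈ M}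

lemma mem_openInvolutions :
    π ∈ openInvolutions L M ↔
      Involutive π ∧ (∀ i ∉ L ∪ M, π i = i) ∧ ∀ i ∈ L, π i ∈ M := by
  simp [openInvolutions]

lemma apply_mem_of_mem_openInvolutions (hπ : π ∈ openInvolutions L M) {i : α} (hi : i ∈ L ∪ M) :
    π i ∈ L ∪ M := by
  obtain ⟨hinv, hfix, -⟩ := mem_openInvolutions.1 hπ
  by_contra hπi
  exact hπi (by rwa [← hinv.injective (hfix _ hπi)] at hi)

lemma openInvolutions_empty_empty : openInvolutions (∅ : Finset α) ∅ = {1} := by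
  ext π
  simp +contextual [mem_openInvolutions, Equiv.ext_iff, Involutive, iff_def]

lemma openInvolutions_empty_right (hL : L.Nonempty) : openInvolutions L ∅ = ∅ := by
  obtain ⟨i, hi⟩ := hL
  refine eq_empty_of_forall_notMem fun π hπ => ?_
  exact notMem_empty _ ((mem_openInvolutions.1 hπ).2.2 i hi)

lemma filter_apply_mem_openInvolutions (hLM : Disjoint L (insert m M)) :
    {π ∈ openInvolutions L (insert m M) | π m ∈ M} = openInvolutions (insert m L) M := by
  ext π
  -- If `π m ∈ M`, then no `i ∈ L` has `π i = m`, since `π m = i` is not in `M`.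
  simp only [mem_filter, mem_openInvolutions, Involutive]
  grind [disjoint_left]

lemma filter_apply_eq_self_openInvolutions (hLM : Disjoint L (insert m M)) (hm : m ∉ M) :
    {π ∈ openInvolutions L (insert m M) | π m = m} = openInvolutions L M := by
  ext π
  simp only [mem_filter, mem_openInvolutions, Involutive]
  grind [disjoint_left]

lemma swap_mul_mem_openInvolutions_iff (hLM : Disjoint L (insert m M)) (hm : m ∉ M) (hj : j ∈ L) :
    Equiv.swap j m * π ∈ openInvolutions L (insert m M) ∧ (Equiv.swap j m * π) m = j ↔
      π ∈ openInvolutions (L.erase j) M := by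
  have hmL : m ∉ L := fun h => disjoint_left.1 hLM h (mem_insert_self m M)
  have hjM : j ∉ M := fun h => disjoint_left.1 hLM hj (mem_insert_of_mem h)
  -- Both sides force `π j = j` and `π m = m`: the product just adds the arc from `j` to `m`.
  simp only [mem_openInvolutions, Involutive, Equiv.Perm.mul_apply, Equiv.swap_apply_def]
  constructor <;> grind

lemma sum_filter_apply_eq_openInvolutions {N : Type*} [AddCommMonoid N]
    (hLM : Disjoint L (insert m M)) (hm : m ∉ M) (hj : j ∈ L) (f : Equiv.Perm α → N) :
    ∑ π ∈ openInvolutions L (insert m M) with π m = j, f π =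
      ∑ π ∈ openInvolutions (L.erase j) M, f (Equiv.swap j m * π) := by
  refine (sum_equiv (Equiv.mulLeft (Equiv.swap j m)) (fun π => ?_) fun _ _ => rfl).symm
  rw [mem_filter, ← swap_mul_mem_openInvolutions_iff hLM hm hj, Equiv.coe_mulLeft]

/-- The three sums correspond to the position `m` being the left end of an arc, a fixed point, or
the right end of an arc from `j`. -/
theorem sum_openInvolutions_insert {N : Type*} [AddCommMonoid N] (hLM : Disjoint L (insert m M))
    (hm : m ∉ M) (f : Equiv.Perm α → N) :
    ∑ π ∈ openInvolutions L (insert m M), f π =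
      ∑ π ∈ openInvolutions (insert m L) M, f π + ∑ π ∈ openInvolutions L M, f π +
        ∑ j ∈ L, ∑ π ∈ openInvolutions (L.erase j) M, f (Equiv.swap j m * π) := by
  have hmaps : ∀ π ∈ openInvolutions L (insert m M), π m ∈ M ∪ {m} ∪ L := fun π hπ => by
    have := apply_mem_of_mem_openInvolutions hπ (i := m) (by simp)
    grind
  have hM : ∑ k ∈ M, ∑ π ∈ openInvolutions L (insert m M) with π m = k, f π =
      ∑ π ∈ openInvolutions L (insert m M) with π m ∈ M, f π := by
    rw [← sum_fiberwise_of_maps_to (fun π hπ => (mem_filter.1 hπ).2)]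
    refine sum_congr rfl fun k hk => sum_congr ?_ fun _ _ => rfl
    grind
  have hdisj : Disjoint (M ∪ {m}) L := by
    rw [disjoint_comm]
    simpa [union_comm] using hLM
  rw [← sum_fiberwise_of_maps_to hmaps, sum_union hdisj, sum_union (by simpa using hm),
    sum_singleton, hM, filter_apply_mem_openInvolutions hLM,
    filter_apply_eq_self_openInvolutions hLM hm]
  congr 1
  exact sum_congr rfl fun j hj => sum_filter_apply_eq_openInvolutions hLM hm hj f

end OpenInvolutions

section Statistics

open Finset Function

variable {α : Type*} [LinearOrder α]

/-- The number of fixed points of `f` in `A`. -/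
def fpOn (A : Finset α) (f : α → α) : ℕ := #{i ∈ A | f i = i}

/-- The number of excedances of `f` at positions in `A`. -/
def excOn (A : Finset α) (f : α → α) : ℕ := #{i ∈ A | i < f i}

/-- The number of inversions of `f` at positions in `A`. -/
def invOn (A : Finset α) (f : α → α) : ℕ := #{e ∈ A ×ˢ A | e.1 < e.2 ∧ f e.2 < f e.1}

/-- The number of nestings of `f` at positions in `A`: pairs `i < k` such that the arc or fixed
point `k ≤ f k` lies below the arc from `i`. -/
def nestOn (A : Finset α) (f : α → α) : ℕ :=
  #{e ∈ A ×ˢ A | e.1 < e.2 ∧ e.2 ≤ f e.2 ∧ f e.2 < f e.1}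

/-- The number of arcs of `f` that start in `A` to the left of `a` and end to the right of `b`. -/
def arcsOver (A : Finset α) (f : α → α) (a b : α) : ℕ := #{i ∈ A | i < a ∧ b < f i}

variable {A : Finset α} {f : α → α} {a j m : α}

lemma card_filter_product_insert {P : α × α → Prop} [DecidablePred P] (ha : a ∉ A)
    (hP : ¬ P (a, a)) :
    #{e ∈ insert a A ×ˢ insert a A | P e} =
      #{e ∈ A ×ˢ A | P e} + #{i ∈ A | P (i, a)} + #{k ∈ A | P (a, k)} := by
  simp only [card_filter, sum_product, sum_insert ha, sum_add_distrib, if_neg hP]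
  ring

lemma card_filter_lt_apply_lt (hf : Involutive f) (hA : ∀ i ∈ A, f i ∈ A) (a b : α) :
    #{k ∈ A | a < k ∧ f k < b} = arcsOver A f b a := by
  refine card_nbij' f f ?_ ?_ (fun k _ => hf k) (fun k _ => hf k) <;>
    simp +contextual [Set.MapsTo, hA, hf _]

lemma fpOn_insert_fixed (hm : m ∉ A) (hfm : f m = m) :
    fpOn (insert m A) f = fpOn A f + 1 := by
  rw [fpOn, filter_insert, if_pos hfm, card_insert_of_notMem (by simp [hm]), fpOn]

lemma excOn_insert_fixed (hfm : f m = m) : excOn (insert m A) f = excOn A f := by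
  rw [excOn, filter_insert, if_neg (by simp [hfm]), excOn]

lemma invOn_insert_fixed (hf : Involutive f) (hA : ∀ i ∈ A, f i ∈ A) (hm : m ∉ A)
    (hfm : f m = m) : invOn (insert m A) f = invOn A f + 2 * arcsOver A f m m := by
  rw [invOn, card_filter_product_insert hm (by simp)]
  simp only [hfm]
  rw [card_filter_lt_apply_lt hf hA, invOn, arcsOver]
  ring

lemma nestOn_insert_fixed (hm : m ∉ A) (hfm : f m = m) :
    nestOn (insert m A) f = nestOn A f + arcsOver A f m m := by
  have hbelow : ∀ k ∈ A, ¬ (m < k ∧ k ≤ f k ∧ f k < m) := by grind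
  rw [nestOn, card_filter_product_insert hm (by simp)]
  simp only [hfm, le_refl, true_and]
  rw [filter_false_of_mem hbelow, card_empty, add_zero, nestOn, arcsOver]

lemma fpOn_insert_arc (hjm : j < m) (hfj : f j = m) (hfm : f m = j) :
    fpOn (insert m (insert j A)) f = fpOn A f := by
  rw [fpOn, filter_insert, if_neg (by simp [hfm, hjm.ne]), filter_insert,
    if_neg (by simp [hfj, hjm.ne']), fpOn]

lemma excOn_insert_arc (hjA : j ∉ A) (hjm : j < m) (hfj : f j = m) (hfm : f m = j) :
    excOn (insert m (insert j A)) f = excOn A f + 1 := by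
  rw [excOn, filter_insert, if_neg (by simp [hfm, hjm.le]), filter_insert,
    if_pos (by simp [hfj, hjm]), card_insert_of_notMem (by simp [hjA]), excOn]

lemma invOn_insert_arc (hf : Involutive f) (hA : ∀ i ∈ A, f i ∈ A) (hjA : j ∉ A) (hmA : m ∉ A)
    (hjm : j < m) (hfj : f j = m) (hfm : f m = j) :
    invOn (insert m (insert j A)) f =
      invOn A f + 2 * arcsOver A f j m + 2 * arcsOver A f m j + 1 := by
  have hmjA : m ∉ insert j A := by simp [hjm.ne', hmA]
  rw [invOn, card_filter_product_insert hmjA (by simp), card_filter_product_insert hjA (by simp)]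
  simp only [hfj, hfm]
  rw [filter_insert, if_pos (by simp [hfj, hjm]), card_insert_of_notMem (by simp [hjA]),
    filter_insert, if_neg (by simp [hjm.le]), card_filter_lt_apply_lt hf hA,
    card_filter_lt_apply_lt hf hA, invOn, arcsOver, arcsOver]
  ring

lemma nestOn_insert_arc (hjA : j ∉ A) (hmA : m ∉ A) (hjm : j < m) (hfj : f j = m)
    (hfm : f m = j) :
    nestOn (insert m (insert j A)) f =
      nestOn A f + arcsOver A f j m + #{k ∈ A | j < k ∧ k ≤ f k ∧ f k < m} := by
  have hmjA : m ∉ insert j A := by simp [hjm.ne', hmA]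
  have hbelow : ∀ k ∈ insert j A, ¬ (m < k ∧ k ≤ f k ∧ f k < j) := by grind
  rw [nestOn, card_filter_product_insert hmjA (by simp), card_filter_product_insert hjA (by simp)]
  simp only [hfj, hfm, hjm.le, hjm.not_ge, true_and, false_and, and_false, filter_false, card_empty]
  rw [filter_false_of_mem hbelow, card_empty, nestOn, arcsOver, add_zero, add_zero]

end Statistics

section Weights

open Finset Function

variable {α R : Type*} [LinearOrder α]

/-- The joint weight of `f` on `A` by fixed points, excedances, inversions and nestings. -/
def weightOn [CommSemiring R] (x v q p : R) (A : Finset α) (f : α → α) : R :=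
  x ^ fpOn A f * v ^ excOn A f * q ^ invOn A f * p ^ nestOn A f

variable {A : Finset α} {f g : α → α} {a b j m : α}

lemma weightOn_congr [CommSemiring R] (x v q p : R) (h : ∀ i ∈ A, f i = g i) :
    weightOn x v q p A f = weightOn x v q p A g := by
  have hfp : fpOn A f = fpOn A g := congrArg card (filter_congr (by grind))
  have hexc : excOn A f = excOn A g := congrArg card (filter_congr (by grind))
  have hinv : invOn A f = invOn A g := congrArg card (filter_congr (by grind))
  have hnest : nestOn A f = nestOn A g := congrArg card (filter_congr (by grind))
  rw [weightOn, weightOn, hfp, hexc, hinv, hnest]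

lemma sum_pow_card_filter_lt [CommRing R] (r : R) (L : Finset α) :
    ∑ j ∈ L, r ^ #{i ∈ L | i < j} = qInt #L r := by
  induction L using Finset.induction_on_max with
  | empty => simp [qInt]
  | insert a L ha ih =>
    have haL : a ∉ L := fun h => lt_irrefl a (ha a h)
    rw [sum_insert haL, card_insert_of_notMem haL, qInt, sum_range_succ, ← qInt, ← ih, add_comm]
    congr 1
    · refine sum_congr rfl fun j hj => ?_
      rw [filter_insert, if_neg (ha j hj).not_gt]
    · rw [filter_insert, if_neg (lt_irrefl a), filter_true_of_mem ha]

variable {L M : Finset α}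

lemma arcsOver_union (hf : ∀ i ∈ L, f i ∈ M) (ha : ∀ k ∈ M, a ≤ k) (hb : ∀ k ∈ M, b < k) :
    arcsOver (L ∪ M) f a b = #{i ∈ L | i < a} := by
  unfold arcsOver
  congr 1
  grind

variable [Fintype α] [CommSemiring R] {π : Equiv.Perm α}

lemma weightOn_insert_fixed (x v q p : R) (hL : ∀ i ∈ L, i < m) (hM : ∀ k ∈ M, m < k)
    (hπ : π ∈ openInvolutions L M) :
    weightOn x v q p (insert m (L ∪ M)) π =
      x * (q ^ 2 * p) ^ #L * weightOn x v q p (L ∪ M) π := by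
  obtain ⟨hinv, hfix, hLM⟩ := mem_openInvolutions.1 hπ
  have hm : m ∉ L ∪ M := by grind
  have hstable := fun i => apply_mem_of_mem_openInvolutions hπ (i := i)
  have hover : arcsOver (L ∪ M) π m m = #L := by
    rw [arcsOver_union hLM (fun k hk => (hM k hk).le) hM, filter_true_of_mem hL]
  rw [weightOn, fpOn_insert_fixed hm (hfix m hm), excOn_insert_fixed (hfix m hm),
    invOn_insert_fixed hinv hstable hm (hfix m hm), nestOn_insert_fixed hm (hfix m hm), hover,
    weightOn]
  ring

lemma weightOn_insert_arc (x v q p : R) (hL : ∀ i ∈ L, i < m) (hM : ∀ k ∈ M, m < k) (hj : j ∈ L)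
    (hπ : π ∈ openInvolutions L (insert m M)) (hπm : π m = j) :
    weightOn x v q p (insert m (L ∪ M)) π =
      v * q ^ (2 * #L - 1) * (q ^ 2 * p) ^ #{i ∈ L | i < j} *
        weightOn x v q p (L.erase j ∪ M) π := by
  obtain ⟨hinv, -, hLM⟩ := mem_openInvolutions.1 hπ
  have hπj : π j = m := by rw [← hπm, hinv]
  have hjm : j < m := hL j hj
  have hjA : j ∉ L.erase j ∪ M := by grind
  have hmA : m ∉ L.erase j ∪ M := by grind
  have hopen : ∀ i ∈ L.erase j, π i ∈ M := fun i hi => by grind [hinv i]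
  have hstable : ∀ i ∈ L.erase j ∪ M, π i ∈ L.erase j ∪ M := fun i hi => by
    have := apply_mem_of_mem_openInvolutions hπ (i := i) (by grind)
    grind [hinv i]
  have hover_arc : arcsOver (L.erase j ∪ M) π j m = #{i ∈ L | i < j} := by
    rw [arcsOver_union hopen (fun k hk => (hjm.trans (hM k hk)).le) hM]
    congr 1
    grind
  have hover_left : arcsOver (L.erase j ∪ M) π m j = #L - 1 := by
    rw [arcsOver_union hopen (fun k hk => (hM k hk).le) (fun k hk => hjm.trans (hM k hk)),
      filter_true_of_mem (by grind), card_erase_of_mem hj]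
  have hbelow : ∀ k ∈ L.erase j ∪ M, ¬ (j < k ∧ k ≤ π k ∧ π k < m) := by grind
  have hinsert : insert m (L ∪ M) = insert m (insert j (L.erase j ∪ M)) := by grind
  have hexp : 2 * #L - 1 = 2 * (#L - 1) + 1 := by have := card_pos.2 ⟨j, hj⟩; omega
  rw [hinsert, weightOn, fpOn_insert_arc hjm hπj hπm, excOn_insert_arc hjA hjm hπj hπm,
    invOn_insert_arc hinv hstable hjA hmA hjm hπj hπm, nestOn_insert_arc hjA hmA hjm hπj hπm,
    filter_false_of_mem hbelow, hover_arc, hover_left, card_empty, hexp, weightOn]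
  ring

lemma weightOn_insert_swap_mul (x v q p : R) (hL : ∀ i ∈ L, i < m) (hM : ∀ k ∈ M, m < k)
    (hj : j ∈ L) (hπ : π ∈ openInvolutions (L.erase j) M) :
    weightOn x v q p (insert m (L ∪ M)) (Equiv.swap j m * π : Equiv.Perm α) =
      v * q ^ (2 * #L - 1) * (q ^ 2 * p) ^ #{i ∈ L | i < j} *
        weightOn x v q p (L.erase j ∪ M) π := by
  have hdisj : Disjoint L (insert m M) := disjoint_left.2 (by grind)
  have hmM : m ∉ M := fun h => lt_irrefl m (hM m h)
  obtain ⟨hmem, hmj⟩ := (swap_mul_mem_openInvolutions_iff hdisj hmM hj).2 hπ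
  rw [weightOn_insert_arc x v q p hL hM hj hmem hmj]
  congr 1
  refine weightOn_congr x v q p fun i hi => ?_
  have hπi := apply_mem_of_mem_openInvolutions hπ hi
  exact Equiv.swap_apply_of_ne_of_ne (by grind) (by grind)

end Weights

section Recursion

open Finset

variable {α R : Type*} [LinearOrder α] [Fintype α] {L M : Finset α} {m : α}

/-- The total weight of the open involutions with open arcs from `L` and unread positions `M`. -/
noncomputable def openSum [CommSemiring R] (x v q p : R) (L M : Finset α) : R :=
  ∑ π ∈ openInvolutions L M, weightOn x v q p (L ∪ M) π

lemma openSum_insert [CommRing R] (x v q p : R) (hL : ∀ i ∈ L, i < m) (hM : ∀ k ∈ M, m < k) :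
    openSum x v q p L (insert m M) =
      openSum x v q p (insert m L) M + x * (q ^ 2 * p) ^ #L * openSum x v q p L M +
        ∑ j ∈ L, v * q ^ (2 * #L - 1) * (q ^ 2 * p) ^ #{i ∈ L | i < j} *
          openSum x v q p (L.erase j) M := by
  have hdisj : Disjoint L (insert m M) := disjoint_left.2 (by grind)
  have hmM : m ∉ M := fun h => lt_irrefl m (hM m h)
  simp only [openSum, mul_sum]
  rw [sum_openInvolutions_insert hdisj hmM, union_insert, insert_union]
  congr 1
  · congr 1
    exact sum_congr rfl fun π hπ => weightOn_insert_fixed x v q p hL hM hπ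
  · exact sum_congr rfl fun j hj => sum_congr rfl fun π hπ =>
      weightOn_insert_swap_mul x v q p hL hM hj hπ

lemma openSum_empty_right [CommSemiring R] (d l : ℕ → R) (x v q p : R) (L : Finset α) :
    openSum x v q p L ∅ = motzkin d l 0 #L := by
  rcases L.eq_empty_or_nonempty with rfl | hL
  · simp [openSum, openInvolutions_empty_empty, weightOn, fpOn, excOn, invOn, nestOn, motzkin]
  · obtain ⟨h, hh⟩ := Nat.exists_eq_succ_of_ne_zero hL.card_ne_zero
    simp [openSum, openInvolutions_empty_right hL, hh, motzkin]

theorem openSum_eq_motzkin [CommRing R] (x v q p : R) (hLM : ∀ i ∈ L, ∀ k ∈ M, i < k) :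
    openSum x v q p L M =
      motzkin (fun h => v * q ^ (2 * h - 1) * qInt h (q ^ 2 * p)) (fun h => x * (q ^ 2 * p) ^ h)
        #M #L := by
  induction M using Finset.induction_on_min generalizing L with
  | empty => exact openSum_empty_right _ _ x v q p L
  | insert m M hm ih =>
    have hL : ∀ i ∈ L, i < m := fun i hi => hLM i hi m (mem_insert_self m M)
    have hmL : m ∉ L := fun h => lt_irrefl m (hL m h)
    have hmM : m ∉ M := fun h => lt_irrefl m (hm m h)
    have hclose : ∀ j ∈ L, openSum x v q p (L.erase j) M = motzkin _ _ #M (#L - 1) :=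
      fun j hj => by rw [ih (by grind), card_erase_of_mem hj]
    rw [openSum_insert x v q p hL hm, ih (by grind), ih (L := L) (by grind),
      sum_congr rfl fun j hj => by rw [hclose j hj], ← sum_mul, ← mul_sum, sum_pow_card_filter_lt,
      card_insert_of_notMem hmL, card_insert_of_notMem hmM]
    rcases #L with _ | h <;> simp [motzkin, qInt]

end Recursion

section Involutions

open Finset Function

variable {n : ℕ} {π : Equiv.Perm (Fin n)}

lemma isInvolution_iff_involutive : IsInvolution π ↔ Involutive π := by
  refine ⟨fun h i => ?_, fun h => h.symm_eq_self_of_involutive⟩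
  nth_rewrite 1 [← show π⁻¹ = π from h]
  exact π.symm_apply_apply i

lemma IsInvolution.dexc_eq_zero (hπ : IsInvolution π) : dexc π = 0 := by
  rw [dexc, card_eq_zero, filter_eq_empty_iff]
  rintro i - ⟨hi, hi'⟩
  rw [isInvolution_iff_involutive.1 hπ i] at hi'
  exact lt_asymm hi hi'

lemma fp_add_card_support (π : Equiv.Perm (Fin n)) : fp π + #π.support = n := by
  simpa [fp, Equiv.Perm.support] using
    card_filter_add_card_filter_not (s := univ) (fun i => π i = i)

lemma cyc_eq_card_cycleType_add_fp (π : Equiv.Perm (Fin n)) :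
    cyc π = π.cycleType.card + fp π := by
  have := fp_add_card_support π
  rw [cyc, Equiv.Perm.parts_partition, Multiset.card_add, Multiset.card_replicate,
    Fintype.card_fin]
  omega

lemma IsInvolution.card_support (hπ : IsInvolution π) : #π.support = 2 * exc π := by
  have hinv := isInvolution_iff_involutive.1 hπ
  have hlt : #{i | π i < i} = exc π :=
    card_nbij' π π (by simp [Set.MapsTo, hinv _]) (by simp [Set.MapsTo, hinv _])
      (fun i _ => hinv i) fun i _ => hinv i
  have hsupp : π.support = ({i | π i < i ∨ i < π i} : Finset (Fin n)) := by
    ext i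
    simp only [Equiv.Perm.mem_support, ne_iff_lt_or_gt, mem_filter_univ]
  rw [hsupp, filter_or, card_union_of_disjoint (disjoint_filter.2 fun i _ h => h.not_gt), hlt, exc,
    two_mul]

lemma IsInvolution.card_support_eq_cycleType (hπ : IsInvolution π) :
    #π.support = 2 * π.cycleType.card := by
  have hsq : π ^ 2 = 1 := by rw [sq, mul_eq_one_iff_inv_eq]; exact hπ
  rw [← Equiv.Perm.sum_cycleType,
    Multiset.eq_replicate_card.2 (Equiv.Perm.pow_prime_eq_one_iff.1 hsq), Multiset.sum_replicate,
    Multiset.card_replicate, smul_eq_mul, mul_comm]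

lemma IsInvolution.cyc_eq (hπ : IsInvolution π) : cyc π = fp π + exc π := by
  have hcycles := cyc_eq_card_cycleType_add_fp π
  have := hπ.card_support
  have := hπ.card_support_eq_cycleType
  omega

lemma avoids_pattern321_iff (π : Equiv.Perm (Fin n)) :
    Avoids π pattern321 ↔ ∀ a b c, a < b → b < c → π c < π b → ¬ π b < π a := by
  refine ⟨fun h a b c hab hbc hcb hba => h ⟨![a, b, c], ?_, ?_⟩, ?_⟩
  · simp [Fin.strictMono_iff_lt_succ, Fin.forall_fin_two, hab, hbc]
  · have hca := hcb.trans hba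
    intro i k
    fin_cases i <;> fin_cases k <;>
      simp [pattern321, hcb, hba, hca, hcb.le, hba.le, hca.le]
  · rintro h ⟨f, hf, hfπ⟩
    exact h (f 0) (f 1) (f 2) (hf (by decide)) (hf (by decide))
      ((hfπ 2 1).2 (by decide)) ((hfπ 1 0).2 (by decide))

lemma nestOn_univ_eq_zero_iff :
    nestOn univ π = 0 ↔ ∀ i k, i < k → k ≤ π k → ¬ π k < π i := by
  simp [nestOn, filter_eq_empty_iff]

lemma IsInvolution.avoids_pattern321_iff (hπ : IsInvolution π) :
    Avoids π pattern321 ↔ nestOn univ π = 0 := by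
  have hinv := isInvolution_iff_involutive.1 hπ
  rw [PermJFraction.avoids_pattern321_iff, nestOn_univ_eq_zero_iff]
  constructor
  · intro h i k hik hk hki
    rcases hk.eq_or_lt with hk | hk
    · exact h i k (π i) hik (by rwa [← hk] at hki) (by rwa [hinv, ← hk]) hki
    · exact h i k (π k) hik hk (by rwa [hinv]) hki
  · intro h a b c hab hbc hcb hba
    rcases le_or_gt b (π b) with hb | hb
    · exact h a b hab hb hba
    · exact h (π c) (π b) hcb (by rw [hinv]; exact hb.le) (by rwa [hinv, hinv])

end Involutions

section GeneratingFunctions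

open Finset

variable {R : Type*} [CommRing R]

open Classical in
lemma openInvolutions_empty_univ (n : ℕ) :
    openInvolutions (∅ : Finset (Fin n)) univ = univ.filter IsInvolution := by
  ext π
  simp [mem_openInvolutions, isInvolution_iff_involutive]

lemma IsInvolution.weightOn_univ {n : ℕ} {π : Equiv.Perm (Fin n)} (hπ : IsInvolution π)
    (x v t q p : R) :
    weightOn (x * t) (v * t) q p univ π =
      x ^ fp π * v ^ exc π * t ^ cyc π * q ^ inv π * p ^ nestOn univ π := by
  have hfp : fpOn univ π = fp π := rfl
  have hexc : excOn univ π = exc π := rfl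
  have hinv : invOn univ π = inv π := by rw [invOn, inv, univ_product_univ]
  rw [weightOn, hfp, hexc, hinv, hπ.cyc_eq]
  ring

open Classical in
theorem mk_sum_isInvolution_eq_jFraction (x v t q p : R) :
    PowerSeries.mk (fun n => ∑ π : Equiv.Perm (Fin n) with IsInvolution π,
        x ^ fp π * v ^ exc π * t ^ cyc π * q ^ inv π * p ^ nestOn univ π) =
      jFraction (fun h => v * t * q ^ (2 * h - 1) * qInt h (q ^ 2 * p))
        (fun h => x * t * (q ^ 2 * p) ^ h) := by
  ext n
  have hsum := openSum_eq_motzkin (x * t) (v * t) q p (L := (∅ : Finset (Fin n))) (M := univ)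
    (by simp)
  rw [openSum, empty_union, openInvolutions_empty_univ, card_empty, card_univ, Fintype.card_fin]
    at hsum
  rw [coeff_mk, coeff_jFraction, ← hsum]
  exact sum_congr rfl fun π hπ => ((mem_filter_univ π).1 hπ).weightOn_univ x v t q p |>.symm

theorem genFun_isInvolution (x v t q : R) :
    genFun (fun _ π => IsInvolution π) x v t q =
      jFraction (fun h => v * t * q ^ (2 * h - 1) * qInt h (q ^ 2))
        (fun h => x * t * q ^ (2 * h)) := by
  unfold genFun
  simpa only [one_pow, mul_one, ← pow_mul] using mk_sum_isInvolution_eq_jFraction x v t q 1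

lemma qInt_succ_zero (h : ℕ) : qInt (h + 1) (0 : R) = 1 := by
  simp [qInt, sum_range_succ']

theorem genFun_isInvolution_avoids (x v t q : R) :
    genFun (fun _ π => IsInvolution π ∧ Avoids π pattern321) x v t q =
      jFraction (fun h => v * t * q ^ (2 * h - 1)) (fun h => if h = 0 then x * t else 0) := by
  have hl : (fun h => x * t * (q ^ 2 * 0) ^ h) = fun h => if h = 0 then x * t else 0 := by
    funext h
    cases h <;> simp
  have hd : jFraction (fun h => v * t * q ^ (2 * h - 1) * qInt h (q ^ 2 * 0))
        (fun h => x * t * (q ^ 2 * 0) ^ h) =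
      jFraction (fun h => v * t * q ^ (2 * h - 1)) (fun h => x * t * (q ^ 2 * 0) ^ h) :=
    jFraction_congr fun h => by rw [mul_zero, qInt_succ_zero, mul_one]
  rw [← hl, ← hd, ← mk_sum_isInvolution_eq_jFraction, genFun]
  congr 1
  funext n
  rw [sum_filter, sum_filter]
  refine sum_congr rfl fun π _ => ?_
  by_cases hπ : IsInvolution π
  · simp [hπ, hπ.avoids_pattern321_iff, zero_pow_eq]
  · simp [hπ]

end GeneratingFunctions

end PermJFraction

theorem mainTheorem12 {R : Type*} [CommRing R] (x v t q : R) :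
    (∀ (n : ℕ) (π : Equiv.Perm (Fin n)),
      PermJFraction.IsInvolution π → PermJFraction.dexc π = 0) ∧
    PermJFraction.genFun (fun _ π => PermJFraction.IsInvolution π) x v t q =
      PermJFraction.jFraction
        (fun h => v * t * q ^ (2 * h - 1) * PermJFraction.qInt h (q ^ 2))
        (fun h => x * t * q ^ (2 * h)) ∧
    PermJFraction.genFun
        (fun _ π => PermJFraction.IsInvolution π ∧
          PermJFraction.Avoids π PermJFraction.pattern321) x v t q =
      PermJFraction.jFraction
        (fun h => v * t * q ^ (2 * h - 1))
        (fun h => if h = 0 then x * t else 0) :=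
  ⟨fun _ _ hπ => hπ.dexc_eq_zero, PermJFraction.genFun_isInvolution x v t q,
    PermJFraction.genFun_isInvolution_avoids x v t q⟩
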